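/- Conventions. For $A\in\mathbb R^{m\times n}$ and $x\in\mathbb R^n$, $\operatorname{sign}(Ax)\in\{-1,0,1\}^m$ is the entrywise sign, with $\operatorname{sign}(0)=0$; $\operatorname{supp}(x)=\{j: x_j\ne 0\}$; $x$ is $k$-sparse if $|\operatorname{supp}(x)|\le k$. A vector $z$ *recovers* a nonzero $x$ *to accuracy* $\varepsilon$ if $z\neq 0$ and $\bigl\|x/\|x\|_2-z/\|z\|_2\bigr\|_2\le\varepsilon$. A $0/1$ matrix with $n$ columns is *$(k,l)$-list disjunct* if for all disjoint sets $S,T$ of columns with $|S|=k$, $|T|=l$ there is a row having a nonzero entry in some column of $T$ and zeros in all columns of $S$. A vector $x$ has *no cancellation* for $A$ if for every row $A_i$, with $S_i=\operatorname{supp}(A_i)\cap\operatorname{supp}(x)$, either $S_i=\emptyset$ or $\sum_{j\in S_i}A_{i,j}x_j\ne 0$. A map $g:\{-1,0,1\}^m\times\mathcal P([n])\to\mathbb R^n$ is a *decoder for $A\in\mathbb R^{m\times n}$ within supersets of size $L$, for $s$-sparse signals and accuracy $\varepsilon$*, if for every $T\subseteq[n]$ with $|T|\le L$ and every nonzero $s$-sparse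 $x$ with $\operatorname{supp}(x)\subseteq T$, the vector $g(\operatorname{sign}(Ax),T)$ is supported in $T$ and recovers $x$ to accuracy $\varepsilon$. **Theorem.** (1) Let $M^{(1)}$ be a $(k,l)$-list disjunct matrix with $m_1$ rows and $n$ columns. There is a map $D:\{-1,0,1\}^{m_1}\to\mathcal P([n])$ such that every $k$-sparse $x\in\mathbb R^n$ with no cancellation for $M^{(1)}$ satisfies $\operatorname{supp}(x)\subseteq D(\operatorname{sign}(M^{(1)}x))$ and $|D(\operatorname{sign}(M^{(1)}x))|\le k+l$, and such that the following holds. Let $M^{(2)}\in\mathbb R^{m_2\times n}$, let $g$ be a decoder for $M^{(2)}$ within supersets of size $k+l$, for $k$-sparse signals and accuracy $\varepsilon$, and let $M=\begin{bmatrix}M^{(1)}\\M^{(2)}\end{bmatrix}$. Then the two-stage decoder $f(y_1,y_2)=g(y_2,D(y_1))$ applied to $\operatorname{sign}(Mx)$ recovers to accuracy $\varepsilon$ every nonzero $k$-sparse $x\in\mathbb R^n$ with no cancellation for $M^{(1)}$. (2) For every constant $c>0$ there is a constant $C>0$ such that for all integers $n\ge 2$ and $1\le k\le n$ and all $0<\varepsilon\le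 1$, with $l=\lceil ck\rceil$, there exist a $(k,l)$-list disjunct matrix $M^{(1)}$ with $n$ columns and at most $C\,k\log\frac nk$ rows, and a matrix $M^{(2)}$ with $n$ columns and at most $C\,\frac k\varepsilon\log\frac{n^{3/2}}{k\varepsilon}$ rows that has a decoder within supersets of size $k+l$, for all signals supported in the superset (that is, for $(k+l)$-sparse signals) and accuracy $\varepsilon$. In particular the stacked matrix $M$ has at most $C\bigl(k\log\frac nk+\frac k\varepsilon\log\frac{n^{3/2}}{k\varepsilon}\bigr)$ rows. -/

import Mathlib

open scoped Matrix

/-- The support of a real vector, as a finite set of coordinates. -/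
noncomputable def vecSupport {n : ℕ} (x : Fin n → ℝ) : Finset (Fin n) :=
  Finset.univ.filter fun j => x j ≠ 0

/-- `x` is `k`-sparse: it has at most `k` nonzero coordinates. -/
def IsSparse {n : ℕ} (k : ℕ) (x : Fin n → ℝ) : Prop :=
  (vecSupport x).card ≤ k

/-- The vector of sign measurements `sign (A x) ∈ {-1, 0, 1}^ι`. -/
noncomputable def signMeas {ι : Type*} {n : ℕ} (A : Matrix ι (Fin n) ℝ)
    (x : EuclideanSpace ℝ (Fin n)) : ι → SignType :=
  fun i => SignType.sign ((A *ᵥ x.ofLp) i)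

/-- The direction `x / ‖x‖₂` (only ever used for `x ≠ 0`). -/
noncomputable def direction {n : ℕ} (x : EuclideanSpace ℝ (Fin n)) :
    EuclideanSpace ℝ (Fin n) :=
  ‖x‖⁻¹ • x

/-- `z` is a nonzero vector that approximates the direction of `x` to accuracy `ε`. -/
def ApproximatesDirection {n : ℕ} (ε : ℝ) (x z : EuclideanSpace ℝ (Fin n)) : Prop :=
  z ≠ 0 ∧ ‖direction x - direction z‖ ≤ ε

/-- A `0/1` matrix is `(k, l)`-list disjunct if for any two disjoint sets `S`, `T` of columns with
`|S| = k` and `|T| = l` some row has a nonzero entry in a column of `T` and zeros in all columns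
of `S`. -/
def IsListDisjunct {m n : ℕ} (k l : ℕ) (A : Matrix (Fin m) (Fin n) ℝ) : Prop :=
  (∀ i j, A i j = 0 ∨ A i j = 1) ∧
    ∀ S T : Finset (Fin n), Disjoint S T → S.card = k → T.card = l →
      ∃ i, (∃ j ∈ T, A i j ≠ 0) ∧ ∀ j ∈ S, A i j = 0

/-- No cancellation: for every row `A i`, with `Sᵢ = supp (A i) ∩ supp x`, either `Sᵢ` is empty or
the inner product of `A i` and `x`, both restricted to `Sᵢ`, is nonzero. -/
def NoCancellation {m n : ℕ} (A : Matrix (Fin m) (Fin n) ℝ) (x : Fin n → ℝ) : Prop :=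
  ∀ i, vecSupport (A i) ∩ vecSupport x = ∅ ∨
    ∑ j ∈ vecSupport (A i) ∩ vecSupport x, A i j * x j ≠ 0

/-- `f` is a decoder that recovers every nonzero signal of the class `X` to accuracy `ε` from its
sign measurements under `A`. -/
def IsApproxDecoder {ι : Type*} {n : ℕ} (A : Matrix ι (Fin n) ℝ)
    (f : (ι → SignType) → EuclideanSpace ℝ (Fin n))
    (X : Set (EuclideanSpace ℝ (Fin n))) (ε : ℝ) : Prop :=
  ∀ x ∈ X, x ≠ 0 → ApproximatesDirection ε x (f (signMeas A x))

/-- `D` recovers, from the sign measurements under `A`, a superset of size at most `L` of the support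
of every signal of the class `X`. -/
def IsSupersetDecoder {ι : Type*} {n : ℕ} (A : Matrix ι (Fin n) ℝ)
    (D : (ι → SignType) → Finset (Fin n))
    (X : Set (EuclideanSpace ℝ (Fin n))) (L : ℕ) : Prop :=
  ∀ x ∈ X, vecSupport x.ofLp ⊆ D (signMeas A x) ∧ (D (signMeas A x)).card ≤ L

/-- `g` is a decoder for recovery within a superset: given any set `T` of at most `L` coordinates and
the sign measurements under `A` of any nonzero `s`-sparse signal `x` supported in `T`, it returns a
vector supported in `T` that recovers `x` to accuracy `ε`. -/
def IsDecoderWithin {ι : Type*} {n : ℕ} (A : Matrix ι (Fin n) ℝ)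
    (g : (ι → SignType) → Finset (Fin n) → EuclideanSpace ℝ (Fin n))
    (s L : ℕ) (ε : ℝ) : Prop :=
  ∀ T : Finset (Fin n), T.card ≤ L →
    ∀ x : EuclideanSpace ℝ (Fin n), IsSparse s x.ofLp → vecSupport x.ofLp ⊆ T → x ≠ 0 →
      vecSupport (g (signMeas A x) T).ofLp ⊆ T ∧
        ApproximatesDirection ε x (g (signMeas A x) T)

/-- The two-stage decoder for stacked measurements: compute a superset `D y₁` of the support from the
first block `y₁`, then decode the second block `y₂` within that superset. -/
def twoStageDecoder {ι₁ ι₂ : Type*} {n : ℕ} (D : (ι₁ → SignType) → Finset (Fin n))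
    (g : (ι₂ → SignType) → Finset (Fin n) → EuclideanSpace ℝ (Fin n))
    (y : ι₁ ⊕ ι₂ → SignType) : EuclideanSpace ℝ (Fin n) :=
  g (y ∘ Sum.inr) (D (y ∘ Sum.inl))

/-- The `k`-sparse signals in `ℝⁿ` satisfying the no-cancellation property with respect to `A`. -/
def admissibleSignals {m n : ℕ} (k : ℕ) (A : Matrix (Fin m) (Fin n) ℝ) :
    Set (EuclideanSpace ℝ (Fin n)) :=
  {x | IsSparse k x.ofLp ∧ NoCancellation A x.ofLp}

/-! Without cancellation a sign measurement is nonzero exactly when its row meets the support, so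
the first block acts as group testing. Keep the columns all of whose tests are nonzero. They contain
the support. If more than k + l were kept, pad the support to a kept k-set S and choose l other kept
columns T; the row that hits T and misses S reads zero, which contradicts keeping T. The second
block then decodes inside this superset.

Both matrices come from one greedy covering argument (`exists_fun_forall_exists_mem`): fewer than
exp(pm) events of probability at least p can all be hit by m sample points, which become the rows.
For list disjunctness the entries are Bernoulli of mean 1/(k+1); p depends only on c, and there are
exp(O(k log(n/k))) pairs (S, T). For the second block the rows are Gaussian; unit vectors at
distance at least ε are separated with margin ε/4 with probability of order ε. Rounding leaves
poly(n/ε)^K classes of pairs, and the margin lets one representative serve its whole class. Any unit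
vector in T consistent with the signs is then a valid output. -/

/-! ### Support supersets by group testing -/

theorem signMeas_ne_zero_iff {m n : ℕ} {A : Matrix (Fin m) (Fin n) ℝ}
    {x : EuclideanSpace ℝ (Fin n)} (hx : NoCancellation A x.ofLp) (i : Fin m) :
    signMeas A x i ≠ 0 ↔ ∃ j, A i j ≠ 0 ∧ x.ofLp j ≠ 0 := by
  have hsum : (A *ᵥ x.ofLp) i = ∑ j ∈ vecSupport (A i) ∩ vecSupport x.ofLp, A i j * x.ofLp j := by
    rw [Matrix.mulVec, dotProduct]
    symm
    apply Finset.sum_subset (Finset.subset_univ _)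
    intro j _ hj
    simp only [vecSupport, Finset.mem_inter, Finset.mem_filter, Finset.mem_univ, true_and,
      not_and_or, not_not] at hj
    rcases hj with h | h <;> simp [h]
  rw [signMeas, Ne, sign_eq_zero_iff, hsum]
  constructor
  · intro h
    obtain ⟨j, -, hj⟩ := Finset.exists_ne_zero_of_sum_ne_zero h
    exact ⟨j, left_ne_zero_of_mul hj, right_ne_zero_of_mul hj⟩
  · rintro ⟨j, h1, h2⟩
    refine (hx i).resolve_left ?_
    exact Finset.ne_empty_of_mem (a := j) (by simp [vecSupport, h1, h2])

/-- The coordinates all of whose measurements are nonzero. -/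
noncomputable def positiveColumns {m n : ℕ} (A : Matrix (Fin m) (Fin n) ℝ)
    (y : Fin m → SignType) : Finset (Fin n) := by
  classical exact Finset.univ.filter fun j => ∀ i, A i j ≠ 0 → y i ≠ 0

theorem mem_positiveColumns {m n : ℕ} {A : Matrix (Fin m) (Fin n) ℝ} {y : Fin m → SignType}
    {j : Fin n} : j ∈ positiveColumns A y ↔ ∀ i, A i j ≠ 0 → y i ≠ 0 := by
  simp [positiveColumns]

theorem IsListDisjunct.isSupersetDecoder {m n k l : ℕ} {A : Matrix (Fin m) (Fin n) ℝ}
    (hA : IsListDisjunct k l A) :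
    IsSupersetDecoder A (positiveColumns A) (admissibleSignals k A) (k + l) := by
  rintro x ⟨hk, hx⟩
  have hsub : vecSupport x.ofLp ⊆ positiveColumns A (signMeas A x) := by
    intro j hj
    rw [mem_positiveColumns]
    intro i hi
    exact (signMeas_ne_zero_iff hx i).2 ⟨j, hi, by simpa [vecSupport] using hj⟩
  refine ⟨hsub, ?_⟩
  by_contra! hcard
  obtain ⟨S, hxS, hSD, hS⟩ := Finset.exists_subsuperset_card_eq hsub hk (by lia)
  obtain ⟨T, hT, hTl⟩ := Finset.exists_subset_card_eq
    (s := positiveColumns A (signMeas A x) \ S) (n := l)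
    (by rw [Finset.card_sdiff_of_subset hSD]; lia)
  have hST : Disjoint S T := (Finset.sdiff_disjoint.mono_left hT).symm
  obtain ⟨i, ⟨j, hjT, hj⟩, hi⟩ := hA.2 S T hST hS hTl
  have hjD := mem_positiveColumns.1 (Finset.mem_sdiff.1 (hT hjT)).1 i hj
  obtain ⟨j', h1, h2⟩ := (signMeas_ne_zero_iff hx i).1 hjD
  exact h1 (hi j' (hxS (by simpa [vecSupport] using h2)))

theorem twoStageDecoder_isApproxDecoder {m₁ m₂ n k L : ℕ} {A : Matrix (Fin m₁) (Fin n) ℝ}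
    {B : Matrix (Fin m₂) (Fin n) ℝ} {D : (Fin m₁ → SignType) → Finset (Fin n)}
    {g : (Fin m₂ → SignType) → Finset (Fin n) → EuclideanSpace ℝ (Fin n)} {ε : ℝ}
    (hD : IsSupersetDecoder A D (admissibleSignals k A) L) (hg : IsDecoderWithin B g k L ε) :
    IsApproxDecoder (Matrix.fromRows A B) (twoStageDecoder D g) (admissibleSignals k A) ε := by
  intro x hx hx0
  obtain ⟨hsub, hcard⟩ := hD x hx
  exact (hg _ hcard x hx.1 hsub hx0).2

/-! ### Greedy covering -/

section Covering

open MeasureTheory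

-- The expected number of events containing a random point is at least p times their number, and
-- some point attains the mean.
open Classical in
theorem exists_card_mul_le_card_filter_mem {Ω ι : Type*} [MeasurableSpace Ω] (μ : Measure Ω)
    [IsProbabilityMeasure μ] {G : ι → Set Ω} (hG : ∀ c, MeasurableSet (G c)) {p : ℝ}
    (S : Finset ι) (hp : ∀ c ∈ S, p ≤ μ.real (G c)) :
    ∃ ω, p * S.card ≤ ((S.filter fun c => ω ∈ G c).card : ℝ) := by
  classical
  have hint : ∀ c ∈ S, Integrable ((G c).indicator fun _ => (1 : ℝ)) μ := fun c _ =>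
    (integrable_const 1).indicator (hG c)
  obtain ⟨ω, hω⟩ := exists_integral_le (integrable_finsetSum S hint)
  refine ⟨ω, le_trans ?_ (hω.trans (le_of_eq ?_))⟩
  · rw [integral_finsetSum S hint]
    calc p * S.card = ∑ _c ∈ S, p := by simp [mul_comm]
      _ ≤ _ := Finset.sum_le_sum fun c hc => by
        rw [integral_indicator_const _ (hG c)]
        simpa using hp c hc
  · simp [Set.indicator_apply]

-- Each new point is chosen to hit at least a fraction p of the events still missed.
open Classical in
theorem exists_fun_card_filter_notMem_le {Ω ι : Type*} [MeasurableSpace Ω] (μ : Measure Ω)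
    [IsProbabilityMeasure μ] {G : ι → Set Ω} (hG : ∀ c, MeasurableSet (G c)) {p : ℝ}
    (hp1 : p ≤ 1) (S : Finset ι) (hp : ∀ c ∈ S, p ≤ μ.real (G c)) (m : ℕ) :
    ∃ ω : Fin m → Ω, ((S.filter fun c => ∀ i, ω i ∉ G c).card : ℝ) ≤ S.card * (1 - p) ^ m := by
  classical
  induction m with
  | zero => exact ⟨Fin.elim0, by simp⟩
  | succ m ih =>
    obtain ⟨ω, hω⟩ := ih
    set S' := S.filter fun c => ∀ i, ω i ∉ G c with hS'
    obtain ⟨a, ha⟩ := exists_card_mul_le_card_filter_mem μ hG S'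
      fun c hc => hp c (Finset.mem_filter.1 hc).1
    refine ⟨Fin.cons a ω, ?_⟩
    have heq : (S.filter fun c => ∀ i, (Fin.cons a ω : Fin (m + 1) → Ω) i ∉ G c) =
        S'.filter fun c => ¬ a ∈ G c := by
      ext c
      simp [hS', Fin.forall_fin_succ]
      tauto
    have hadd := Finset.card_filter_add_card_filter_not (s := S') (fun c => a ∈ G c)
    have hadd' : ((S'.filter fun c => a ∈ G c).card : ℝ) +
        ((S'.filter fun c => ¬ a ∈ G c).card : ℝ) = S'.card := by exact_mod_cast hadd
    rw [heq]
    calc ((S'.filter fun c => ¬ a ∈ G c).card : ℝ) ≤ S'.card * (1 - p) := by linarith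
      _ ≤ (S.card * (1 - p) ^ m) * (1 - p) := by gcongr
      _ = _ := by ring

/-- Greedy covering: sets of probability at least `p` can all be hit by `m` points as soon as
their number is less than `exp (p * m)`. -/
theorem exists_fun_forall_exists_mem {Ω ι : Type*} [MeasurableSpace Ω] (μ : Measure Ω)
    [IsProbabilityMeasure μ] {G : ι → Set Ω} (hG : ∀ c, MeasurableSet (G c)) {p : ℝ}
    (S : Finset ι) (hp : ∀ c ∈ S, p ≤ μ.real (G c)) {m : ℕ}
    (hm : (S.card : ℝ) < Real.exp (p * m)) :
    ∃ ω : Fin m → Ω, ∀ c ∈ S, ∃ i, ω i ∈ G c := by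
  classical
  have : Nonempty Ω := nonempty_of_isProbabilityMeasure μ
  rcases S.eq_empty_or_nonempty with rfl | ⟨c₀, hc₀⟩
  · exact ⟨fun _ => Classical.arbitrary Ω, by simp⟩
  have hp1 : p ≤ 1 := (hp c₀ hc₀).trans measureReal_le_one
  obtain ⟨ω, hω⟩ := exists_fun_card_filter_notMem_le μ hG hp1 S hp m
  refine ⟨ω, fun c hc => ?_⟩
  by_contra! hcon
  have h1 : (1 : ℝ) ≤ ((S.filter fun c => ∀ i, ω i ∉ G c).card : ℝ) := by
    exact_mod_cast Finset.card_pos.2 ⟨c, by simp [hc, hcon]⟩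
  have h2 : (1 - p) ^ m ≤ Real.exp (-(p * m)) := by
    calc (1 - p) ^ m ≤ Real.exp (-p) ^ m :=
          pow_le_pow_left₀ (by linarith) (Real.one_sub_le_exp_neg p) m
      _ = _ := by rw [← Real.exp_nat_mul]; ring_nf
  have h3 : (S.card : ℝ) * (1 - p) ^ m < 1 := by
    calc (S.card : ℝ) * (1 - p) ^ m ≤ S.card * Real.exp (-(p * m)) := by gcongr
      _ < Real.exp (p * m) * Real.exp (-(p * m)) := by gcongr
      _ = 1 := by rw [← Real.exp_add]; simp
  linarith

end Covering

/-! ### Random list disjunct matrices -/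

section ListDisjunct

open MeasureTheory ProbabilityTheory

theorem choose_le_exp_mul_div_pow (n k : ℕ) :
    (n.choose k : ℝ) ≤ Real.exp (k * (1 + Real.log (n / k))) := by
  rcases Nat.eq_zero_or_pos k with rfl | hk
  · simp
  rcases Nat.eq_zero_or_pos n with rfl | hn
  · simp [Nat.choose_eq_zero_of_lt hk, Real.exp_nonneg]
  have hk' : (0 : ℝ) < k := by exact_mod_cast hk
  have hn' : (0 : ℝ) < n := by exact_mod_cast hn
  have h1 : (k : ℝ) ^ k / k.factorial ≤ Real.exp k := Real.pow_div_factorial_le_exp _ hk'.le k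
  calc (n.choose k : ℝ) ≤ (n : ℝ) ^ k / k.factorial := Nat.choose_le_pow_div k n
    _ = (k : ℝ) ^ k / k.factorial * (n / k) ^ k := by rw [div_pow]; field_simp
    _ ≤ Real.exp k * (n / k) ^ k := by gcongr
    _ = _ := by
      rw [mul_add, mul_one, Real.exp_add, Real.exp_nat_mul, Real.exp_log (by positivity)]

/-- The event `ω j = 0` stands for a matrix entry 1, so entries are independent with mean 1/(k+1).
-/
theorem measureReal_pi_forall_mem_ne_zero {n k : ℕ} (S : Finset (Fin n)) :
    (Measure.pi fun _ : Fin n => uniformOn (Set.univ : Set (Fin (k + 1)))).real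
      {ω | ∀ j ∈ S, ω j ≠ 0} = ((k : ℝ) / (k + 1)) ^ S.card := by
  classical
  have hset : {ω : Fin n → Fin (k + 1) | ∀ j ∈ S, ω j ≠ 0} =
      Set.univ.pi fun j => if j ∈ S then {0}ᶜ else Set.univ := by
    ext ω
    simp only [Set.mem_ofPred_eq, Set.mem_pi, Set.mem_univ, true_implies]
    refine forall_congr' fun j => ?_
    by_cases hj : j ∈ S <;> simp [hj]
  have h0 : (uniformOn (Set.univ : Set (Fin (k + 1)))).real {0}ᶜ = (k : ℝ) / (k + 1) := by
    rw [probReal_compl_eq_one_sub (measurableSet_singleton _)]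
    rw [measureReal_def, uniformOn_univ]
    have : ((k : ENNReal) + 1).toReal = k + 1 := by
      rw [ENNReal.toReal_add (by simp) (by simp)]
      simp
    simp [this]
    field_simp
    ring
  rw [hset, measureReal_def, Measure.pi_pi, ENNReal.toReal_prod]
  rw [← Finset.prod_subset (Finset.subset_univ S)]
  · rw [← h0, ← Finset.prod_const]
    exact Finset.prod_congr rfl fun j hj => by simp [hj, measureReal_def]
  · intro j _ hj
    simp [hj]

/-- The event is "S avoided" minus "S ∪ T avoided", of probability r^k (1 - r^l) with r = k/(k+1).
Here r^k ≥ 1/e, and r^l ≤ exp(-l/(k+1)) ≤ exp(-c/2) since k + 1 ≤ 2k. -/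
theorem one_sub_exp_le_measureReal_hit {n k l : ℕ} {c : ℝ} (hk : 1 ≤ k) (hl : c * k ≤ l)
    (hc : 0 < c) {S T : Finset (Fin n)} (hST : Disjoint S T) (hS : S.card = k) (hT : T.card = l) :
    Real.exp (-1) * (1 - Real.exp (-(c / 2))) ≤
    (Measure.pi fun _ : Fin n => uniformOn (Set.univ : Set (Fin (k + 1)))).real
      {ω | (∃ j ∈ T, ω j = 0) ∧ ∀ j ∈ S, ω j ≠ 0} := by
  classical
  have hk' : (1 : ℝ) ≤ k := by exact_mod_cast hk
  have hset : {ω : Fin n → Fin (k + 1) | (∃ j ∈ T, ω j = 0) ∧ ∀ j ∈ S, ω j ≠ 0} =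
      {ω | ∀ j ∈ S, ω j ≠ 0} \ {ω | ∀ j ∈ S ∪ T, ω j ≠ 0} := by
    ext ω
    simp only [Set.mem_ofPred_eq, Set.mem_sdiff, Finset.mem_union]
    constructor
    · rintro ⟨⟨j, hj, h0⟩, h⟩
      exact ⟨h, fun h' => h' j (Or.inr hj) h0⟩
    · rintro ⟨h, h'⟩
      push Not at h'
      obtain ⟨j, hj, h0⟩ := h'
      refine ⟨⟨j, hj.resolve_left fun hjS => h j hjS h0, h0⟩, h⟩
  have hsub : {ω : Fin n → Fin (k + 1) | ∀ j ∈ S ∪ T, ω j ≠ 0} ⊆ {ω | ∀ j ∈ S, ω j ≠ 0} := by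
    intro ω h
    simp only [Set.mem_ofPred_eq] at h ⊢
    exact fun j hj => h j (Finset.mem_union_left _ hj)
  rw [hset, measureReal_sdiff hsub
    (Set.toFinite _).measurableSet, measureReal_pi_forall_mem_ne_zero,
    measureReal_pi_forall_mem_ne_zero, Finset.card_union_of_disjoint hST, hS, hT, pow_add]
  set r : ℝ := (k : ℝ) / (k + 1) with hr
  have hr0 : 0 ≤ r := by positivity
  have h1 : Real.exp (-1) ≤ r ^ k := by
    have h2 : r⁻¹ ≤ Real.exp ((k : ℝ)⁻¹) := by
      have : r⁻¹ = (k : ℝ)⁻¹ + 1 := by rw [hr]; field_simp; ring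
      rw [this]
      exact Real.add_one_le_exp _
    have h3 : (r ^ k)⁻¹ ≤ Real.exp 1 := by
      rw [← inv_pow]
      calc r⁻¹ ^ k ≤ Real.exp ((k : ℝ)⁻¹) ^ k := by gcongr
        _ = Real.exp 1 := by
          rw [← Real.exp_nat_mul, mul_inv_cancel₀ (by positivity)]
    rw [Real.exp_neg]
    exact inv_le_of_inv_le₀ (by positivity) h3
  have h2 : r ^ l ≤ Real.exp (-(c / 2)) := by
    have h3 : r ≤ Real.exp (-(1 / (k + 1))) := by
      have : r = 1 - 1 / (k + 1) := by rw [hr]; field_simp; ring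
      rw [this]
      exact Real.one_sub_le_exp_neg _
    calc r ^ l ≤ Real.exp (-(1 / (k + 1))) ^ l := by gcongr
      _ = Real.exp (-(l / (k + 1))) := by rw [← Real.exp_nat_mul]; ring_nf
      _ ≤ _ := by
        rw [Real.exp_le_exp, neg_le_neg_iff, le_div_iff₀ (by positivity)]
        nlinarith
  have h3 : Real.exp (-(c / 2)) ≤ 1 := Real.exp_le_one_iff.2 (by linarith)
  calc _ ≤ r ^ k * (1 - r ^ l) := by gcongr
    _ = _ := by ring

theorem exists_isListDisjunct_of_choose_lt {n k l m : ℕ} {c : ℝ} (hk : 1 ≤ k) (hl : c * k ≤ l)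
    (hc : 0 < c) (hm : (n.choose k * n.choose l : ℝ) <
      Real.exp (Real.exp (-1) * (1 - Real.exp (-(c / 2))) * m)) :
    ∃ A : Matrix (Fin m) (Fin n) ℝ, IsListDisjunct k l A := by
  classical
  let P := (Finset.powersetCard k (Finset.univ : Finset (Fin n)) ×ˢ
    Finset.powersetCard l (Finset.univ : Finset (Fin n)))
  let P' := P.filter fun q => Disjoint q.1 q.2
  let G : Finset (Fin n) × Finset (Fin n) → Set (Fin n → Fin (k + 1)) :=
    fun q => {ω | (∃ j ∈ q.2, ω j = 0) ∧ ∀ j ∈ q.1, ω j ≠ 0}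
  have hcard : (P'.card : ℝ) ≤ n.choose k * n.choose l := by
    have : P'.card ≤ n.choose k * n.choose l :=
      (Finset.card_filter_le _ _).trans (by simp [P])
    exact_mod_cast this
  have hmem : ∀ q ∈ P', q.1.card = k ∧ q.2.card = l ∧ Disjoint q.1 q.2 := by
    intro q hq
    simpa [P', P, Finset.mem_powersetCard, and_assoc] using hq
  obtain ⟨ω, hω⟩ := exists_fun_forall_exists_mem
    (Measure.pi fun _ : Fin n => uniformOn (Set.univ : Set (Fin (k + 1)))) (G := G)
    (fun q => (Set.toFinite _).measurableSet)
    (p := Real.exp (-1) * (1 - Real.exp (-(c / 2)))) P'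
    (fun q hq => one_sub_exp_le_measureReal_hit hk hl hc (hmem q hq).2.2 (hmem q hq).1
      (hmem q hq).2.1) (hcard.trans_lt hm)
  refine ⟨fun i j => if ω i j = 0 then 1 else 0, fun i j => ?_, fun S T hST hS hT => ?_⟩
  · by_cases h : ω i j = 0 <;> simp [h]
  · obtain ⟨i, ⟨j, hj, hj0⟩, hi⟩ := hω (S, T) (by simp [P', P, Finset.mem_powersetCard, *])
    exact ⟨i, ⟨j, hj, by simp [hj0]⟩, fun j hj => by simp [hi j hj]⟩

theorem exists_isListDisjunct (c : ℝ) (hc : 0 < c) : ∃ C : ℝ, 0 < C ∧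
    ∀ n k : ℕ, 1 ≤ k → k ≤ n → ∃ (m : ℕ) (A : Matrix (Fin m) (Fin n) ℝ),
      (m : ℝ) ≤ C * (k * Real.log (n / k)) ∧ IsListDisjunct k ⌈c * k⌉₊ A := by
  set p : ℝ := Real.exp (-1) * (1 - Real.exp (-(c / 2))) with hp
  have hp0 : 0 < p := by
    have : Real.exp (-(c / 2)) < 1 := Real.exp_lt_one_iff.2 (by linarith)
    have := Real.exp_pos (-1)
    rw [hp]
    apply mul_pos <;> linarith
  set b : ℝ := Real.log (1 + c) with hb
  have hb0 : 0 < b := Real.log_pos (by linarith)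
  -- `q` bounds the logarithm of the number of pairs
  set q : ℝ := (1 / b + 1) + (c + 1) * ((1 + |Real.log c|) / b + 1) with hq
  have hq0 : 0 < q := by positivity
  refine ⟨q / p + 1 / b, by positivity, fun n k hk hkn => ?_⟩
  set l := ⌈c * k⌉₊ with hl
  have hk' : (1 : ℝ) ≤ k := by exact_mod_cast hk
  have hkn' : (k : ℝ) ≤ n := by exact_mod_cast hkn
  have hlog0 : 0 ≤ Real.log (n / k) :=
    Real.log_nonneg (by rw [le_div_iff₀ (by linarith)]; linarith)
  -- If k + l > n there are no disjoint pairs and zero rows suffice; this covers n = k, where the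
  -- row bound is 0.
  by_cases hn : k + l ≤ n
  swap
  · refine ⟨0, fun i => i.elim0, ?_, fun i => i.elim0, fun S T hST hS hT => ?_⟩
    · simp only [Nat.cast_zero]
      positivity
    · exfalso
      have := Finset.card_le_univ (S ∪ T)
      rw [Finset.card_union_of_disjoint hST, hS, hT, Fintype.card_fin] at this
      exact hn this
  have hcl : c * k ≤ l := Nat.le_ceil _
  have hlc : (l : ℝ) ≤ (c + 1) * k := by
    have := (Nat.ceil_lt_add_one (show 0 ≤ c * k by positivity)).le
    rw [← hl] at this
    linarith
  have hn' : (k : ℝ) + l ≤ n := by exact_mod_cast hn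
  set t : ℝ := Real.log (n / k) with ht
  -- Now n/k ≥ 1 + c, so t is bounded below and additive constants are absorbed into multiples of t.
  have hbt : b ≤ t := by
    apply Real.log_le_log (by linarith)
    rw [le_div_iff₀ (by linarith)]
    linarith
  have h1t : 1 ≤ t / b := by rwa [le_div_iff₀ hb0, one_mul]
  have hlpos : (0 : ℝ) < l := lt_of_lt_of_le (by positivity) hcl
  have h1 : (n.choose k : ℝ) ≤ Real.exp (k * ((1 / b + 1) * t)) := by
    refine (choose_le_exp_mul_div_pow n k).trans (Real.exp_le_exp.2 ?_)
    gcongr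
    rw [← ht]
    calc 1 + t ≤ t / b + t := by linarith
      _ = _ := by ring
  have h2 : (n.choose l : ℝ) ≤ Real.exp (k * ((c + 1) * ((1 + |Real.log c|) / b + 1) * t)) := by
    refine (choose_le_exp_mul_div_pow n l).trans (Real.exp_le_exp.2 ?_)
    have h3 : Real.log (n / l) ≤ |Real.log c| + t := by
      calc Real.log (n / l) ≤ Real.log (n / (c * k)) := by
            apply Real.log_le_log
            · have : (0 : ℝ) < n := by linarith
              positivity
            · gcongr
        _ = -Real.log c + t := by
            rw [ht, mul_comm, ← div_div,
              Real.log_div (div_pos (by linarith) (by linarith)).ne' hc.ne']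
            ring
        _ ≤ _ := by gcongr; exact neg_le_abs _
    calc (l : ℝ) * (1 + Real.log (n / l)) ≤ l * ((1 + |Real.log c|) * (t / b) + t) := by
          refine mul_le_mul_of_nonneg_left ?_ hlpos.le
          nlinarith [abs_nonneg (Real.log c)]
      _ ≤ ((c + 1) * k) * ((1 + |Real.log c|) * (t / b) + t) := by gcongr
      _ = _ := by ring
  have h3 : (n.choose k * n.choose l : ℝ) ≤ Real.exp (q * (k * t)) := by
    calc (n.choose k * n.choose l : ℝ) ≤ _ := mul_le_mul h1 h2 (by positivity) (by positivity)
      _ = _ := by rw [← Real.exp_add, hq]; ring_nf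
  obtain ⟨A, hA⟩ := exists_isListDisjunct_of_choose_lt (m := ⌊q * (k * t) / p⌋₊ + 1) hk hcl hc
    (h3.trans_lt (by
      rw [Real.exp_lt_exp, ← hp, mul_comm p, ← div_lt_iff₀ hp0]
      exact_mod_cast Nat.lt_floor_add_one _))
  refine ⟨_, A, ?_, hA⟩
  have h4 : ((⌊q * (k * t) / p⌋₊ : ℕ) : ℝ) ≤ q * (k * t) / p := Nat.floor_le (by positivity)
  have h5 : 1 ≤ k * (t / b) := by nlinarith
  push_cast
  calc (⌊q * (k * t) / p⌋₊ : ℝ) + 1 ≤ q * (k * t) / p + k * (t / b) := by linarith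
    _ = _ := by ring

end ListDisjunct

/-! ### Separation by a Gaussian hyperplane -/

section Gaussian

open MeasureTheory ProbabilityTheory
open scoped RealInnerProductSpace NNReal

theorem mul_gaussianPDFReal_le_measureReal_Icc {a b M : ℝ} (hab : a ≤ b) (ha : -M ≤ a)
    (hb : b ≤ M) : gaussianPDFReal 0 1 M * (b - a) ≤ (gaussianReal 0 1).real (Set.Icc a b) := by
  rw [measureReal_def, gaussianReal_apply_eq_integral 0 one_ne_zero, ENNReal.toReal_ofReal
    (integral_nonneg fun x => gaussianPDFReal_nonneg _ _ _)]
  have hle : ∀ x ∈ Set.Icc a b, gaussianPDFReal 0 1 M ≤ gaussianPDFReal 0 1 x := by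
    intro x hx
    rw [gaussianPDFReal, gaussianPDFReal]
    have : (x - 0) ^ 2 ≤ (M - 0) ^ 2 := by
      simp only [sub_zero]
      exact sq_le_sq' (ha.trans hx.1) (hx.2.trans hb)
    gcongr
  calc gaussianPDFReal 0 1 M * (b - a) = ∫ _x in Set.Icc a b, gaussianPDFReal 0 1 M := by
        simp [hab, mul_comm]
    _ ≤ _ := setIntegral_mono_on (by simp) (integrable_gaussianPDFReal 0 1).integrableOn
        measurableSet_Icc hle

theorem measurableSet_separating {E : Type*} [NormedAddCommGroup E] [InnerProductSpace ℝ E]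
    [MeasurableSpace E] [BorelSpace E] (x y : E) (r R : ℝ) :
    MeasurableSet {g : E | r ≤ ⟪x, g⟫ ∧ ⟪y, g⟫ ≤ -r ∧ ‖g‖ < R} := by
  have h1 : Measurable fun g : E => ⟪x, g⟫ := (innerSL ℝ x).continuous.measurable
  have h2 : Measurable fun g : E => ⟪y, g⟫ := (innerSL ℝ y).continuous.measurable
  exact (measurableSet_le measurable_const h1).inter
    ((measurableSet_le h2 measurable_const).inter (measurableSet_lt measurable_norm
      measurable_const))

variable {E : Type*} [NormedAddCommGroup E] [InnerProductSpace ℝ E] [FiniteDimensional ℝ E]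
  [MeasurableSpace E] [BorelSpace E]

theorem map_inner_stdGaussian (v : E) :
    (stdGaussian E).map (fun g => ⟪v, g⟫) = (gaussianReal 0 1).map (fun t => ‖v‖ * t) := by
  have h : HasGaussianLaw (fun g : E => innerSL ℝ v g) (stdGaussian E) :=
    IsGaussian.hasGaussianLaw_id.map_fun (innerSL ℝ v)
  have h1 := h.map_eq_gaussianReal
  have h2 : Var[fun g : E => innerSL ℝ v g; stdGaussian E] = ‖v‖ ^ 2 := by
    rw [variance_dual_stdGaussian, innerSL_apply_norm]
  rw [h2, integral_strongDual_stdGaussian] at h1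
  simp only [innerSL_apply_apply] at h1
  rw [h1, gaussianReal_map_const_mul]
  congr 1
  · simp
  · ext
    simp

/-- Jointly Gaussian variables with zero covariance are independent. -/
theorem indepFun_inner_stdGaussian {u v : E} (huv : ⟪u, v⟫ = 0) :
    IndepFun (fun g => ⟪u, g⟫) (fun g => ⟪v, g⟫) (stdGaussian E) := by
  have h : HasGaussianLaw (fun g : E => ((innerSL ℝ u).prod (innerSL ℝ v)) g) (stdGaussian E) :=
    IsGaussian.hasGaussianLaw_id.map_fun _
  refine HasGaussianLaw.indepFun_of_covariance_eq_zero (X := fun g : E => ⟪u, g⟫)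
    (Y := fun g : E => ⟪v, g⟫) h ?_
  rw [← covarianceBilin_apply_eq_cov IsGaussian.memLp_two_id, covarianceBilin_stdGaussian]
  simpa [innerSL_apply_apply ℝ] using huv

/-- Markov's inequality for ‖g‖², whose mean is the dimension. -/
theorem measureReal_stdGaussian_norm_gt_le {R : ℝ} (hR : 0 < R) :
    (stdGaussian E).real {g | R ≤ ‖g‖} ≤ Module.finrank ℝ E / R ^ 2 := by
  let b := stdOrthonormalBasis ℝ E
  have hb : ∀ i, Integrable (fun g : E => ⟪b i, g⟫ ^ 2) (stdGaussian E) := fun i =>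
    ((IsGaussian.hasGaussianLaw_id.map_fun (innerSL ℝ (b i))).memLp_two).integrable_sq
  have hi : ∀ i, ∫ g, ⟪b i, g⟫ ^ 2 ∂(stdGaussian E) = 1 := by
    intro i
    have h1 := variance_dual_stdGaussian (innerSL ℝ (b i))
    rw [variance_of_integral_eq_zero (by fun_prop) (integral_strongDual_stdGaussian _)] at h1
    simpa using h1
  have hnorm : (fun g : E => ‖g‖ ^ 2) = fun g => ∑ i, ⟪b i, g⟫ ^ 2 := by
    ext g
    rw [b.sum_sq_inner_right]
  have hint : ∫ g, ‖g‖ ^ 2 ∂(stdGaussian E) = Module.finrank ℝ E := by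
    rw [hnorm, integral_finsetSum _ fun i _ => hb i]
    simp [hi]
  have hmk := mul_meas_ge_le_integral_of_nonneg (μ := stdGaussian E) (f := fun g : E => ‖g‖ ^ 2)
    (Filter.Eventually.of_forall fun g => by positivity)
    (by rw [hnorm]; exact integrable_finsetSum _ fun i _ => hb i) (R ^ 2)
  rw [hint] at hmk
  rw [le_div_iff₀ (by positivity), mul_comm]
  refine le_trans ?_ hmk
  have hsub : {g : E | R ≤ ‖g‖} ⊆ {g | R ^ 2 ≤ ‖g‖ ^ 2} := by
    intro g hg
    simp only [Set.mem_ofPred_eq] at hg ⊢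
    gcongr
  gcongr
  exact measure_ne_top _ _

/-- With probability proportional to their distance, two unit vectors are separated by a random
hyperplane, with a margin. -/
theorem le_measureReal_separating {x y : E} (hx : ‖x‖ = 1) (hy : ‖y‖ = 1) {ε R : ℝ}
    (hε : 0 < ε) (hε1 : ε ≤ 1) (hxy : ε ≤ ‖x - y‖) (hR : 0 < R) :
    gaussianPDFReal 0 1 2 * (gaussianPDFReal 0 1 1 * (ε / 2)) - Module.finrank ℝ E / R ^ 2 ≤
      (stdGaussian E).real {g | ε / 4 ≤ ⟪x, g⟫ ∧ ⟪y, g⟫ ≤ -(ε / 4) ∧ ‖g‖ < R} := by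
  -- Since x and y have equal norms, u and v are orthogonal, so their products with g are
  -- independent. With probability of order ε the first is at most ε/4 in absolute value, and with
  -- constant probability the second is at least ε/2; then x = u + v and y = u - v are separated
  -- with margin ε/4.
  set u := (2 : ℝ)⁻¹ • (x + y) with hu
  set v := (2 : ℝ)⁻¹ • (x - y) with hv
  have huv : ⟪u, v⟫ = 0 := by
    rw [hu, hv, real_inner_smul_left, real_inner_smul_right, inner_add_left, inner_sub_right,
      inner_sub_right, real_inner_self_eq_norm_sq, real_inner_self_eq_norm_sq, hx, hy,
      real_inner_comm x y]
    ring
  have hu1 : ‖u‖ ≤ 1 := by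
    rw [hu, norm_smul]
    have := norm_add_le x y
    norm_num
    linarith
  have hvε : ε / 2 ≤ ‖v‖ := by
    rw [hv, norm_smul]
    norm_num
    linarith
  have hmu : Measurable fun g : E => ⟪u, g⟫ := (innerSL ℝ u).continuous.measurable
  have hmv : Measurable fun g : E => ⟪v, g⟫ := (innerSL ℝ v).continuous.measurable
  have hA : gaussianPDFReal 0 1 1 * (ε / 2) ≤
      (stdGaussian E).real ((fun g => ⟪u, g⟫) ⁻¹' Set.Icc (-(ε / 4)) (ε / 4)) := by
    rw [← map_measureReal_apply hmu measurableSet_Icc, map_inner_stdGaussian,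
      map_measureReal_apply (by fun_prop) measurableSet_Icc]
    calc gaussianPDFReal 0 1 1 * (ε / 2) = gaussianPDFReal 0 1 1 * (ε / 4 - -(ε / 4)) := by ring
      _ ≤ (gaussianReal 0 1).real (Set.Icc (-(ε / 4)) (ε / 4)) :=
        mul_gaussianPDFReal_le_measureReal_Icc (by linarith) (by linarith) (by linarith)
      _ ≤ _ := by
        refine measureReal_mono fun t ht => ?_
        simp only [Set.mem_preimage, Set.mem_Icc, ← abs_le, abs_mul, abs_norm] at ht ⊢
        nlinarith [abs_nonneg t]
  have hB : gaussianPDFReal 0 1 2 ≤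
      (stdGaussian E).real ((fun g => ⟪v, g⟫) ⁻¹' Set.Ici (ε / 2)) := by
    rw [← map_measureReal_apply hmv measurableSet_Ici, map_inner_stdGaussian,
      map_measureReal_apply (by fun_prop) measurableSet_Ici]
    calc gaussianPDFReal 0 1 2 = gaussianPDFReal 0 1 2 * (2 - 1) := by ring
      _ ≤ (gaussianReal 0 1).real (Set.Icc 1 2) :=
        mul_gaussianPDFReal_le_measureReal_Icc (by norm_num) (by norm_num) le_rfl
      _ ≤ _ := by
        refine measureReal_mono fun t ht => ?_
        have := ht.1
        simp only [Set.mem_preimage, Set.mem_Ici]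
        nlinarith
  have hAB := IndepFun.measure_inter_preimage_eq_mul (indepFun_inner_stdGaussian huv)
    (Set.Icc (-(ε / 4)) (ε / 4)) (Set.Ici (ε / 2)) measurableSet_Icc measurableSet_Ici
  have hprod : gaussianPDFReal 0 1 2 * (gaussianPDFReal 0 1 1 * (ε / 2)) ≤
      (stdGaussian E).real ((fun g => ⟪u, g⟫) ⁻¹' Set.Icc (-(ε / 4)) (ε / 4) ∩
        (fun g => ⟪v, g⟫) ⁻¹' Set.Ici (ε / 2)) := by
    rw [measureReal_def, hAB, ENNReal.toReal_mul, ← measureReal_def, ← measureReal_def, mul_comm]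
    exact mul_le_mul hA hB (gaussianPDFReal_nonneg _ _ _) measureReal_nonneg
  have htail := measureReal_stdGaussian_norm_gt_le (E := E) hR
  have hunion := measureReal_union_le (μ := stdGaussian E)
    {g | ε / 4 ≤ ⟪x, g⟫ ∧ ⟪y, g⟫ ≤ -(ε / 4) ∧ ‖g‖ < R} {g | R ≤ ‖g‖}
  have hsub : (stdGaussian E).real ((fun g => ⟪u, g⟫) ⁻¹' Set.Icc (-(ε / 4)) (ε / 4) ∩
        (fun g => ⟪v, g⟫) ⁻¹' Set.Ici (ε / 2)) ≤ (stdGaussian E).real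
      ({g | ε / 4 ≤ ⟪x, g⟫ ∧ ⟪y, g⟫ ≤ -(ε / 4) ∧ ‖g‖ < R} ∪ {g | R ≤ ‖g‖}) := by
    refine measureReal_mono ?_
    rintro g ⟨⟨h1, h2⟩, h3⟩
    rcases le_or_gt R ‖g‖ with h | h
    · exact Or.inr h
    · left
      simp only [Set.mem_preimage, Set.mem_Ici] at h1 h2 h3
      have hxg : ⟪x, g⟫ = ⟪u, g⟫ + ⟪v, g⟫ := by
        rw [← inner_add_left, hu, hv]
        congr 1
        module
      have hyg : ⟪y, g⟫ = ⟪u, g⟫ - ⟪v, g⟫ := by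
        rw [← inner_sub_left, hu, hv]
        congr 1
        module
      exact ⟨by rw [hxg]; linarith, by rw [hyg]; linarith, h⟩
  linarith

end Gaussian

/-! ### Rounding sparse unit vectors -/

section Grid

/-- `x` vanishes off the range of `f`, and on this range its coordinates, rounded to multiples of
`h`, are listed by `a`. -/
def HasGridCode {n K N : ℕ} (h : ℝ) (f : Fin K → Fin n) (a : Fin K → Fin N)
    (x : EuclideanSpace ℝ (Fin n)) : Prop :=
  (∀ j ∉ Set.range f, x j = 0) ∧ ∀ i, ⌊(x (f i) + 1) / h⌋₊ = a i

theorem abs_apply_le_one_of_norm_eq_one {n : ℕ} {x : EuclideanSpace ℝ (Fin n)} (hx : ‖x‖ = 1)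
    (j : Fin n) : |x j| ≤ 1 := by
  simpa [hx] using PiLp.norm_apply_le x j

theorem norm_le_mul_of_abs_apply_le {n : ℕ} {x : EuclideanSpace ℝ (Fin n)} {h : ℝ}
    (hx : ∀ j, |x j| ≤ h) : ‖x‖ ≤ n * h := by
  have hsum := (EuclideanSpace.basisFun (Fin n) ℝ).sum_repr x
  rw [← hsum]
  refine (norm_sum_le _ _).trans ?_
  calc ∑ j, ‖(EuclideanSpace.basisFun (Fin n) ℝ).repr x j • EuclideanSpace.basisFun (Fin n) ℝ j‖
      ≤ ∑ _j : Fin n, h := Finset.sum_le_sum fun j _ => by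
        rw [norm_smul, (EuclideanSpace.basisFun (Fin n) ℝ).norm_eq_one, mul_one]
        simpa using hx j
    _ = n * h := by simp

theorem HasGridCode.norm_sub_le {n K N : ℕ} {h : ℝ} (hh : 0 < h) {f : Fin K → Fin n}
    {a : Fin K → Fin N} {x x' : EuclideanSpace ℝ (Fin n)} (hx : ‖x‖ = 1) (hx' : ‖x'‖ = 1)
    (hxa : HasGridCode h f a x) (hxa' : HasGridCode h f a x') : ‖x - x'‖ ≤ n * h := by
  refine norm_le_mul_of_abs_apply_le fun j => ?_
  by_cases hj : j ∈ Set.range f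
  · obtain ⟨i, rfl⟩ := hj
    have key : ∀ z : EuclideanSpace ℝ (Fin n), ‖z‖ = 1 → HasGridCode h f a z →
        (a i : ℝ) * h ≤ z (f i) + 1 ∧ z (f i) + 1 < (a i + 1) * h := by
      intro z hz hza
      have h1 := (abs_le.1 (abs_apply_le_one_of_norm_eq_one hz (f i))).1
      have h0 : 0 ≤ (z (f i) + 1) / h := div_nonneg (by linarith) hh.le
      rw [← le_div_iff₀ hh, ← div_lt_iff₀ hh, ← hza.2 i]
      exact ⟨Nat.floor_le h0, Nat.lt_floor_add_one _⟩
    obtain ⟨h1, h2⟩ := key x hx hxa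
    obtain ⟨h3, h4⟩ := key x' hx' hxa'
    rw [PiLp.sub_apply, abs_le]
    constructor <;> linarith
  · rw [PiLp.sub_apply, hxa.1 j hj, hxa'.1 j hj]
    simpa using hh.le

theorem exists_hasGridCode {n K : ℕ} {h : ℝ} (hh : 0 < h) (f : Fin K → Fin n)
    {x : EuclideanSpace ℝ (Fin n)} (hx : ‖x‖ = 1) (hf : ∀ j ∉ Set.range f, x j = 0) :
    ∃ a : Fin K → Fin (⌊2 / h⌋₊ + 1), HasGridCode h f a x := by
  refine ⟨fun i => ⟨⌊(x (f i) + 1) / h⌋₊, Nat.lt_succ_of_le (Nat.floor_mono ?_)⟩, hf,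
    fun i => rfl⟩
  have := (abs_le.1 (abs_apply_le_one_of_norm_eq_one hx (f i))).2
  gcongr
  linarith

/-- Listing with repetitions lets n^K functions encode all nonempty sets of size at most K. -/
theorem exists_range_eq_of_card_le {n K : ℕ} {T : Finset (Fin n)} (hT : T.Nonempty)
    (hK : T.card ≤ K) : ∃ f : Fin K → Fin n, Set.range f = T := by
  have : Nonempty T := hT.to_subtype
  let e : T ↪ Fin K := T.equivFin.toEmbedding.trans (Fin.castLEEmb hK)
  let d : Fin K → T := Function.invFun e
  refine ⟨fun i => (d i : Fin n), ?_⟩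
  ext j
  constructor
  · rintro ⟨i, rfl⟩
    exact (d i).2
  · intro hj
    exact ⟨e ⟨j, hj⟩, by simp [d, Function.leftInverse_invFun e.injective _]⟩

end Grid

/-! ### Gaussian matrices separating sparse directions -/

section Separation

open MeasureTheory ProbabilityTheory
open scoped RealInnerProductSpace

/-- Unit vectors with a common support set of size at most `K` and with equal sign measurements
are at distance at most `ε`. -/
def SeparatesSparse {m n : ℕ} (A : Matrix (Fin m) (Fin n) ℝ) (K : ℕ) (ε : ℝ) : Prop :=
  ∀ T : Finset (Fin n), T.card ≤ K → ∀ x y : EuclideanSpace ℝ (Fin n), ‖x‖ = 1 → ‖y‖ = 1 →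
    vecSupport x.ofLp ⊆ T → vecSupport y.ofLp ⊆ T → signMeas A x = signMeas A y → ‖x - y‖ ≤ ε

theorem mulVec_eq_inner {m n : ℕ} (ω : Fin m → EuclideanSpace ℝ (Fin n))
    (x : EuclideanSpace ℝ (Fin n)) (i : Fin m) :
    ((Matrix.of fun i j => ω i j) *ᵥ x.ofLp) i = ⟪x, ω i⟫ := by
  simp [PiLp.inner_apply, Matrix.mulVec, dotProduct]

theorem exists_separatesSparse_of_lt_exp {n K m : ℕ} {ε R h p : ℝ} (hε : 0 < ε) (hε1 : ε ≤ 1)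
    (hR : 0 < R) (hh : 0 < h) (hhR : n * h * R < ε / 4)
    (hp : p ≤ gaussianPDFReal 0 1 2 * (gaussianPDFReal 0 1 1 * (ε / 2)) - n / R ^ 2)
    (hm : ((n * (⌊2 / h⌋₊ + 1) ^ 2 : ℕ) : ℝ) ^ K < Real.exp (p * m)) :
    ∃ A : Matrix (Fin m) (Fin n) ℝ, SeparatesSparse A K ε := by
  classical
  let Code := (Fin K → Fin n) × (Fin K → Fin (⌊2 / h⌋₊ + 1)) × (Fin K → Fin (⌊2 / h⌋₊ + 1))
  let Bad : Code → Prop := fun c => ∃ x y : EuclideanSpace ℝ (Fin n), ‖x‖ = 1 ∧ ‖y‖ = 1 ∧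
    HasGridCode h c.1 c.2.1 x ∧ HasGridCode h c.1 c.2.2 y ∧ ε ≤ ‖x - y‖
  have hBad : ∀ c : {c // Bad c}, Bad c.1 := fun c => c.2
  -- Representatives are genuine unit vectors at distance at least ε, not grid points, so the
  -- separation probability applies to them directly.
  choose X Y hX hY hXc hYc hXY using hBad
  have hcard : ((Finset.univ : Finset {c // Bad c}).card : ℝ) < Real.exp (p * m) := by
    refine lt_of_le_of_lt ?_ hm
    have h1 : Fintype.card {c // Bad c} ≤ Fintype.card Code := Fintype.card_subtype_le _
    have h2 : Fintype.card Code = (n * (⌊2 / h⌋₊ + 1) ^ 2) ^ K := by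
      simp only [Code, Fintype.card_prod, Fintype.card_fun, Fintype.card_fin]
      rw [mul_pow, sq, mul_pow]
    rw [Finset.card_univ]
    exact_mod_cast h1.trans_eq h2
  obtain ⟨ω, hω⟩ := exists_fun_forall_exists_mem (stdGaussian (EuclideanSpace ℝ (Fin n)))
    (G := fun c : {c // Bad c} => {g | ε / 4 ≤ ⟪X c, g⟫ ∧ ⟪Y c, g⟫ ≤ -(ε / 4) ∧ ‖g‖ < R})
    (fun c => measurableSet_separating _ _ _ _) Finset.univ
    (fun c _ => le_trans (by simpa using hp)
      (le_measureReal_separating (hX c) (hY c) hε hε1 (hXY c) hR)) hcard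
  refine ⟨Matrix.of fun i j => ω i j, fun T hT x y hx hy hxT hyT hxy => ?_⟩
  by_contra! hlt
  have hTne : T.Nonempty := by
    rw [Finset.nonempty_iff_ne_empty]
    rintro rfl
    have : x = 0 := by
      ext j
      by_contra hj
      exact Finset.notMem_empty j (hxT (by simpa [vecSupport] using hj))
    simp [this] at hx
  obtain ⟨f, hf⟩ := exists_range_eq_of_card_le hTne hT
  have hzero : ∀ z : EuclideanSpace ℝ (Fin n), vecSupport z.ofLp ⊆ T →
      ∀ j ∉ Set.range f, z j = 0 := by
    intro z hz j hj
    by_contra hne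
    rw [hf] at hj
    exact hj (hz (by simpa [vecSupport] using hne))
  obtain ⟨a, ha⟩ := exists_hasGridCode hh f hx (hzero x hxT)
  obtain ⟨b, hb⟩ := exists_hasGridCode hh f hy (hzero y hyT)
  let c : {c // Bad c} := ⟨(f, a, b), x, y, hx, hy, ha, hb, hlt.le⟩
  obtain ⟨i, hi1, hi2, hi3⟩ := hω c (Finset.mem_univ _)
  -- Passing from a representative to x or y moves the product with a row of norm below R by less
  -- than the margin, so the strict signs persist.
  have hclose : ∀ z z' : EuclideanSpace ℝ (Fin n), ‖z - z'‖ ≤ n * h →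
      |⟪z, ω i⟫ - ⟪z', ω i⟫| < ε / 4 := by
    intro z z' hz
    rw [← inner_sub_left]
    calc |⟪z - z', ω i⟫| ≤ ‖z - z'‖ * ‖ω i‖ := abs_real_inner_le_norm _ _
      _ ≤ n * h * R := by gcongr
      _ < ε / 4 := hhR
  have hxi := abs_lt.1 (hclose x (X c) (ha.norm_sub_le hh hx (hX c) (hXc c)))
  have hyi := abs_lt.1 (hclose y (Y c) (hb.norm_sub_le hh hy (hY c) (hYc c)))
  have hsign := congrFun hxy i
  rw [signMeas, signMeas, mulVec_eq_inner, mulVec_eq_inner, sign_pos (by linarith),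
    sign_neg (by linarith)] at hsign
  exact absurd hsign (by decide)

theorem exists_separatesSparse : ∃ C : ℝ, 0 < C ∧ ∀ (n K : ℕ) (ε : ℝ), 2 ≤ n → 1 ≤ K →
    0 < ε → ε ≤ 1 → ∃ (m : ℕ) (A : Matrix (Fin m) (Fin n) ℝ),
      (m : ℝ) ≤ C * (K / ε * Real.log (n / ε)) ∧ SeparatesSparse A K ε := by
  set c₀ : ℝ := gaussianPDFReal 0 1 2 * gaussianPDFReal 0 1 1 / 2 with hc₀
  have hc₀pos : 0 < c₀ := by
    have h1 := gaussianPDFReal_pos 0 1 2 one_ne_zero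
    have h2 := gaussianPDFReal_pos 0 1 1 one_ne_zero
    positivity
  set B : ℝ := 1 + 2 / c₀ with hB
  have hB1 : 1 ≤ B := by
    have : 0 ≤ 2 / c₀ := by positivity
    linarith
  have hlog2 : 0 < Real.log 2 := Real.log_pos (by norm_num)
  have hlogB : 0 ≤ Real.log (17 * B) := Real.log_nonneg (by linarith)
  -- Each support entry costs a factor n and two grid indices of size at most 17B(n/ε)²: five powers
  -- of n/ε in all. The constant is absorbed using W ≥ log 2.
  set Q : ℝ := 5 + 2 * Real.log (17 * B) / Real.log 2 with hQ
  have hQ0 : 0 < Q := by positivity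
  refine ⟨2 * Q / c₀ + 1 / Real.log 2, by positivity, fun n K ε hn hK hε hε1 => ?_⟩
  have hn' : (2 : ℝ) ≤ n := by exact_mod_cast hn
  have hK' : (1 : ℝ) ≤ K := by exact_mod_cast hK
  have hn0 : (0 : ℝ) < n := by linarith
  have hB0 : 0 < B := by linarith
  have hnε : (n : ℝ) ≤ n / ε := by
    rw [le_div_iff₀ hε]
    nlinarith
  set W : ℝ := Real.log (n / ε) with hW
  have hW2 : Real.log 2 ≤ W := Real.log_le_log (by norm_num) (hn'.trans hnε)
  have hW0 : 0 < W := hlog2.trans_le hW2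
  have hW1 : 1 ≤ W / Real.log 2 := by rwa [le_div_iff₀ hlog2, one_mul]
  -- R makes the norm tail at most half of the main probability c₀ε; h makes the rounding error nhR
  -- equal to ε/8.
  set R : ℝ := B * (n / ε) with hR
  set h : ℝ := ε / (8 * n * R) with hh
  have hR0 : 0 < R := by positivity
  have hh0 : 0 < h := by positivity
  have hhR : n * h * R < ε / 4 := by
    have : n * h * R = ε / 8 := by
      rw [hh]
      field_simp
    linarith
  set p : ℝ := c₀ * ε / 2 with hp
  have hp0 : 0 < p := by positivity
  have htail : (n : ℝ) / R ^ 2 ≤ c₀ * ε / 2 := by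
    have h1 : 2 ≤ c₀ * B := by
      rw [hB, mul_add, mul_div_cancel₀ _ hc₀pos.ne']
      linarith
    rw [div_le_iff₀ (by positivity)]
    calc (n : ℝ) ≤ n / ε := hnε
      _ ≤ n / ε * (n * B) := le_mul_of_one_le_right (by positivity) (by nlinarith)
      _ = 2 / 2 * (n / ε) * (n * B) := by ring
      _ ≤ (c₀ * B) / 2 * (n / ε) * (n * B) := by gcongr
      _ = c₀ * ε / 2 * R ^ 2 := by
        rw [hR]
        field_simp
  have hpp : p ≤ gaussianPDFReal 0 1 2 * (gaussianPDFReal 0 1 1 * (ε / 2)) - n / R ^ 2 := by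
    have : gaussianPDFReal 0 1 2 * (gaussianPDFReal 0 1 1 * (ε / 2)) = c₀ * ε := by
      rw [hc₀]
      ring
    rw [this]
    linarith
  have hgrid : ((⌊2 / h⌋₊ + 1 : ℕ) : ℝ) ≤ 17 * B * (n / ε) ^ 2 := by
    have h1 : (⌊2 / h⌋₊ : ℝ) ≤ 2 / h := Nat.floor_le (by positivity)
    have h2 : 2 / h = 16 * B * (n / ε) ^ 2 := by
      rw [hh, hR]
      field_simp
      norm_num
    have h3 : 1 ≤ B * (n / ε) ^ 2 := by
      have : 1 ≤ (n / ε) ^ 2 := one_le_pow₀ (by linarith)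
      nlinarith
    push_cast
    linarith
  have hcount : ((n * (⌊2 / h⌋₊ + 1) ^ 2 : ℕ) : ℝ) ^ K ≤ Real.exp (Q * (K * W)) := by
    have hexpW : Real.exp W = n / ε := Real.exp_log (by positivity)
    have h1 : ((n * (⌊2 / h⌋₊ + 1) ^ 2 : ℕ) : ℝ) ≤ Real.exp (Q * W) := by
      calc ((n * (⌊2 / h⌋₊ + 1) ^ 2 : ℕ) : ℝ) = n * ((⌊2 / h⌋₊ + 1 : ℕ) : ℝ) ^ 2 := by
            push_cast
            ring
        _ ≤ (n / ε) * (17 * B * (n / ε) ^ 2) ^ 2 := by gcongr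
        _ = (17 * B) ^ 2 * (n / ε) ^ 5 := by ring
        _ = Real.exp (2 * Real.log (17 * B) + 5 * W) := by
          rw [Real.exp_add, ← hexpW, ← Real.exp_nat_mul W 5]
          congr 1
          rw [show (2 : ℝ) = ((2 : ℕ) : ℝ) by norm_num, Real.exp_nat_mul,
            Real.exp_log (by positivity)]
        _ ≤ _ := by
          rw [Real.exp_le_exp, hQ]
          calc 2 * Real.log (17 * B) + 5 * W
              ≤ 2 * Real.log (17 * B) * (W / Real.log 2) + 5 * W := by
                have := le_mul_of_one_le_right (by positivity : 0 ≤ 2 * Real.log (17 * B)) hW1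
                linarith
            _ = _ := by ring
    calc _ ≤ Real.exp (Q * W) ^ K := by gcongr
      _ = _ := by rw [← Real.exp_nat_mul]; ring_nf
  obtain ⟨A, hA⟩ := exists_separatesSparse_of_lt_exp (m := ⌊Q * (K * W) / p⌋₊ + 1) hε hε1 hR0 hh0
    hhR hpp (hcount.trans_lt (by
      rw [Real.exp_lt_exp, mul_comm p, ← div_lt_iff₀ hp0]
      exact_mod_cast Nat.lt_floor_add_one _))
  refine ⟨_, A, ?_, hA⟩
  have h4 : ((⌊Q * (K * W) / p⌋₊ : ℕ) : ℝ) ≤ Q * (K * W) / p := Nat.floor_le (by positivity)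
  have h5 : 1 ≤ K / ε * (W / Real.log 2) := by
    have : 1 ≤ K / ε := by
      rw [le_div_iff₀ hε]
      linarith
    exact one_le_mul_of_one_le_of_one_le this hW1
  push_cast
  calc (⌊Q * (K * W) / p⌋₊ : ℝ) + 1 ≤ Q * (K * W) / p + K / ε * (W / Real.log 2) := by linarith
    _ = _ := by
      rw [hp]
      field_simp

theorem vecSupport_smul {n : ℕ} {a : ℝ} (ha : a ≠ 0) (x : EuclideanSpace ℝ (Fin n)) :
    vecSupport (a • x).ofLp = vecSupport x.ofLp := by
  ext j
  simp [vecSupport, ha]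

theorem signMeas_smul {m n : ℕ} (A : Matrix (Fin m) (Fin n) ℝ) {a : ℝ} (ha : 0 < a)
    (x : EuclideanSpace ℝ (Fin n)) : signMeas A (a • x) = signMeas A x := by
  ext i
  simp [signMeas, Matrix.mulVec_smul, sign_mul, sign_pos ha]

/-- Any consistent unit vector in T works; the direction of x is one, so the default 0 is never
returned for actual measurements. -/
theorem SeparatesSparse.exists_isDecoderWithin {m n K : ℕ} {A : Matrix (Fin m) (Fin n) ℝ} {ε : ℝ}
    (hA : SeparatesSparse A K ε) (s : ℕ) :
    ∃ g : (Fin m → SignType) → Finset (Fin n) → EuclideanSpace ℝ (Fin n),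
      IsDecoderWithin A g s K ε := by
  classical
  let P : (Fin m → SignType) → Finset (Fin n) → EuclideanSpace ℝ (Fin n) → Prop :=
    fun y T z => ‖z‖ = 1 ∧ vecSupport z.ofLp ⊆ T ∧ signMeas A z = y
  refine ⟨fun y T => if h : ∃ z, P y T z then h.choose else 0, fun T hT x _ hxT hx0 => ?_⟩
  have hnx : 0 < ‖x‖ := norm_pos_iff.2 hx0
  have hd1 : ‖direction x‖ = 1 := by
    rw [direction, norm_smul, norm_inv, norm_norm, inv_mul_cancel₀ hnx.ne']
  have hdT : vecSupport (direction x).ofLp ⊆ T := by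
    rwa [direction, vecSupport_smul (inv_ne_zero hnx.ne')]
  have hds : signMeas A (direction x) = signMeas A x := signMeas_smul A (inv_pos.2 hnx) x
  have hex : ∃ z, P (signMeas A x) T z := ⟨direction x, hd1, hdT, hds⟩
  obtain ⟨hz1, hzT, hzs⟩ := hex.choose_spec
  simp only [hex, dif_pos]
  refine ⟨hzT, fun h0 => by simp [h0] at hz1, ?_⟩
  have hdz : direction hex.choose = hex.choose := by simp [direction, hz1]
  rw [hdz]
  exact hA T hT _ _ hd1 hz1 hdT hzT (hds.trans hzs.symm)

end Separation

/-! ### Assembly of the row bounds -/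

/-- As k ≤ n, the right-hand argument is at least √n/ε, whose square is at least n/ε. -/
theorem log_div_le_two_mul_log {n k : ℕ} {ε : ℝ} (hk : 1 ≤ k) (hkn : k ≤ n) (hε : 0 < ε)
    (hε1 : ε ≤ 1) :
    Real.log (n / ε) ≤ 2 * Real.log ((n : ℝ) ^ ((3 : ℝ) / 2) / (k * ε)) := by
  have hk' : (0 : ℝ) < k := by exact_mod_cast hk
  have hkn' : (k : ℝ) ≤ n := by exact_mod_cast hkn
  have hn : (0 : ℝ) < n := hk'.trans_le hkn'
  have h1 : Real.log k ≤ Real.log n := Real.log_le_log hk' hkn'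
  have h2 : Real.log ε ≤ 0 := Real.log_nonpos hε.le hε1
  rw [Real.log_div hn.ne' hε.ne', Real.log_div (by positivity) (by positivity),
    Real.log_rpow hn, Real.log_mul hk'.ne' hε.ne']
  linarith

theorem mainTheorem1 :
    -- the stacked matrix recovers every admissible signal, by the two-stage scheme
    (∀ (n m₁ k l : ℕ) (M₁ : Matrix (Fin m₁) (Fin n) ℝ), IsListDisjunct k l M₁ →
      ∃ D : (Fin m₁ → SignType) → Finset (Fin n),
        IsSupersetDecoder M₁ D (admissibleSignals k M₁) (k + l) ∧
        ∀ (m₂ : ℕ) (M₂ : Matrix (Fin m₂) (Fin n) ℝ) (ε : ℝ)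
          (g : (Fin m₂ → SignType) → Finset (Fin n) → EuclideanSpace ℝ (Fin n)),
          IsDecoderWithin M₂ g k (k + l) ε →
            IsApproxDecoder (Matrix.fromRows M₁ M₂) (twoStageDecoder D g)
              (admissibleSignals k M₁) ε) ∧
    -- matrices with the stated numbers of rows exist
    (∀ c : ℝ, 0 < c → ∃ C : ℝ, 0 < C ∧
      ∀ (n k : ℕ) (ε : ℝ), 2 ≤ n → 1 ≤ k → k ≤ n → 0 < ε → ε ≤ 1 →
        ∃ (m₁ m₂ : ℕ) (M₁ : Matrix (Fin m₁) (Fin n) ℝ) (M₂ : Matrix (Fin m₂) (Fin n) ℝ)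
          (g : (Fin m₂ → SignType) → Finset (Fin n) → EuclideanSpace ℝ (Fin n)),
          (m₁ : ℝ) ≤ C * (k * Real.log (n / k)) ∧
          (m₂ : ℝ) ≤ C * (k / ε * Real.log ((n : ℝ) ^ ((3 : ℝ) / 2) / (k * ε))) ∧
          ((m₁ + m₂ : ℕ) : ℝ) ≤ C * (k * Real.log (n / k) +
            k / ε * Real.log ((n : ℝ) ^ ((3 : ℝ) / 2) / (k * ε))) ∧
          IsListDisjunct k ⌈c * k⌉₊ M₁ ∧
          IsDecoderWithin M₂ g (k + ⌈c * k⌉₊) (k + ⌈c * k⌉₊) ε) := by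
  refine ⟨fun n m₁ k l M₁ hM₁ => ⟨positiveColumns M₁, hM₁.isSupersetDecoder,
    fun m₂ M₂ ε g hg => twoStageDecoder_isApproxDecoder hM₁.isSupersetDecoder hg⟩,
    fun c hc => ?_⟩
  obtain ⟨C₁, hC₁, h₁⟩ := exists_isListDisjunct c hc
  obtain ⟨C₂, hC₂, h₂⟩ := exists_separatesSparse
  -- The factor c + 2 bounds (k + l)/k, and the 2 comes from comparing the logarithms.
  refine ⟨max C₁ (C₂ * (c + 2) * 2), lt_max_of_lt_left hC₁, fun n k ε hn hk hkn hε hε1 => ?_⟩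
  obtain ⟨m₁, M₁, hm₁, hM₁⟩ := h₁ n k hk hkn
  obtain ⟨m₂, M₂, hm₂, hM₂⟩ := h₂ n (k + ⌈c * k⌉₊) ε hn (by lia) hε hε1
  obtain ⟨g, hg⟩ := hM₂.exists_isDecoderWithin (k + ⌈c * k⌉₊)
  have hk' : (1 : ℝ) ≤ k := by exact_mod_cast hk
  have hkn' : (k : ℝ) ≤ n := by exact_mod_cast hkn
  have hlog : 0 ≤ Real.log (n / k) :=
    Real.log_nonneg (by rw [le_div_iff₀ (by linarith)]; linarith)
  have hW : 0 ≤ Real.log (n / ε) :=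
    Real.log_nonneg (by rw [le_div_iff₀ hε]; linarith)
  have hL := log_div_le_two_mul_log hk hkn hε hε1
  set L := Real.log ((n : ℝ) ^ ((3 : ℝ) / 2) / (k * ε))
  have hL0 : 0 ≤ L := by linarith
  have hK : ((k + ⌈c * k⌉₊ : ℕ) : ℝ) ≤ (c + 2) * k := by
    have := (Nat.ceil_lt_add_one (show 0 ≤ c * k by positivity)).le
    push_cast
    linarith
  have b₁ : (m₁ : ℝ) ≤ max C₁ (C₂ * (c + 2) * 2) * (k * Real.log (n / k)) :=
    hm₁.trans (by gcongr; exact le_max_left _ _)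
  have b₂ : (m₂ : ℝ) ≤ max C₁ (C₂ * (c + 2) * 2) * (k / ε * L) := by
    calc (m₂ : ℝ) ≤ _ := hm₂
      _ ≤ C₂ * ((c + 2) * k / ε * (2 * L)) := by gcongr
      _ = C₂ * (c + 2) * 2 * (k / ε * L) := by ring
      _ ≤ _ := by gcongr; exact le_max_right _ _
  refine ⟨m₁, m₂, M₁, M₂, g, b₁, b₂, ?_, hM₁, hg⟩
  push_cast
  linarith
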